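/- Let $\mathbb{F}_q$ be a finite field with $q$ elements and characteristic $p$, and let $n \ge 1$. A generalized triangular dynamical system (GTDS) over $\mathbb{F}_q$ is given by permutation polynomials $p_1,\dots,p_n \in \mathbb{F}_q[x]$ and, for $1 \le i \le n-1$, polynomials $g_i, h_i \in \mathbb{F}_q[x_{i+1},\dots,x_n]$ such that $g_i$ has no zero over $\mathbb{F}_q$. It induces the map $\mathcal{F} = (f_1,\dots,f_n) : \mathbb{F}_q^n \to \mathbb{F}_q^n$ with $$f_i(x_1,\dots,x_n) = p_i(x_i)\, g_i(x_{i+1},\dots,x_n) + h_i(x_{i+1},\dots,x_n) \quad (1 \le i \le n-1), \qquad f_n(x_1,\dots,x_n) = p_n(x_n).$$ For $c \in \mathbb{F}_q^\times$ and $\mathbf{a},\mathbf{b} \in \mathbb{F}_q^n$, the entry of the $c$-boomerang connectivity table of $\mathcal{F}$ at $(\mathbf{a},\mathbf{b})$ is $${}_c\mathcal{B}_{\mathcal{F}}(\mathbf{a},\mathbf{b}) = \left|\left\{(\mathbf{x},\mathbf{y}) \in \mathbb{F}_q^n \times \mathbb{F}_q^n \;\middle|\; \mathcal{F}(\mathbf{x}+\mathbf{y})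 - c\,\mathcal{F}(\mathbf{x}) = \mathbf{b},\ \ c\,\mathcal{F}(\mathbf{x}+\mathbf{y}+\mathbf{a}) - \mathcal{F}(\mathbf{x}+\mathbf{a}) = c\,\mathbf{b}\right\}\right|.$$ Theorem. Let $\mathcal{F}$ be a GTDS over $\mathbb{F}_q$ such that $p_i(x) = x^{d_i}$ with $\gcd(d_i, q-1) = 1$ and $p \nmid d_i$ for all $1 \le i \le n$, and $h_i = 0$ for all $1 \le i \le n-1$. Let $\mathbf{a},\mathbf{b} \in \mathbb{F}_q^n \setminus \{\mathbf{0}\}$ and $c \in \mathbb{F}_q^\times$. Then $${}_c\mathcal{B}_{\mathcal{F}}(\mathbf{a},\mathbf{b}) \;\le\; B_n \cdot \prod_{i=1}^{n-1} B_i,$$ where, for $1 \le i \le n-1$, $$B_i = \begin{cases} q, & d_i = 1 \text{ or } a_i b_i = 0, \\ d_i^2, & d_i > 1 \text{ and } a_i b_i \ne 0, \end{cases}$$ and $$B_n = \begin{cases} 1, & d_n = 1,\ c \ne 1, \text{ and } (c \neq -1 \text{ or } a_n \ne 0), \\ q, & d_n = 1, \text{ and } (c = 1 \text{ or } (c = -1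 \text{ and } a_n = 0)), \\ q, & d_n > 1 \text{ and } a_n b_n = 0, \\ d_n^2, & d_n > 1 \text{ and } a_n b_n \ne 0. \end{cases}$$ -/

import Mathlib

/-- A generalized triangular dynamical system in `m + 1` variables over `K`
(so the number `n = m + 1` of branches is an arbitrary integer `n ≥ 1`).
The branches are indexed by `Fin (m + 1)`; the branches other than the last one are the
`i.castSucc` with `i : Fin m`.  For such a branch, `g i` and `h i` are polynomials in the variables
of strictly larger index, and `g i` has no zero over `K`. -/
structure GTDS (K : Type*) [Field K] (m : ℕ) where
  p : Fin (m + 1) → Polynomial K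
  g : (i : Fin m) → MvPolynomial {j : Fin (m + 1) // i.castSucc < j} K
  h : (i : Fin m) → MvPolynomial {j : Fin (m + 1) // i.castSucc < j} K
  p_perm : ∀ i, Function.Bijective fun x : K => (p i).eval x
  g_ne_zero : ∀ i x, MvPolynomial.eval x (g i) ≠ 0

namespace GTDS

variable {K : Type*} [Field K] {m : ℕ}

/-- The polynomials `f₁, …, fₙ` of the system: `fᵢ = pᵢ(xᵢ) gᵢ(xᵢ₊₁, …, xₙ) + hᵢ(xᵢ₊₁, …, xₙ)`
for `i < n`, and `fₙ = pₙ(xₙ)`. -/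
noncomputable def poly (F : GTDS K m) (i : Fin (m + 1)) : MvPolynomial (Fin (m + 1)) K :=
  Fin.lastCases (motive := fun _ => MvPolynomial (Fin (m + 1)) K)
    (Polynomial.aeval (MvPolynomial.X (Fin.last m)) (F.p (Fin.last m)))
    (fun i => Polynomial.aeval (MvPolynomial.X i.castSucc) (F.p i.castSucc)
        * MvPolynomial.rename Subtype.val (F.g i)
      + MvPolynomial.rename Subtype.val (F.h i))
    i

/-- The function `K ^ n → K ^ n` induced by the system. -/
noncomputable def map (F : GTDS K m) (x : Fin (m + 1) → K) : Fin (m + 1) → K :=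
  fun i => MvPolynomial.eval x (F.poly i)

end GTDS

/-- The entry at `(a, b)` of the `c`-boomerang connectivity table of `F : K ^ n → K ^ r`:
the number of pairs `(x, y)` with `F (x + y) - c F x = b` and
`c F (x + y + a) - F (x + a) = c b`. -/
noncomputable def cBCT {K : Type*} [Field K] {n r : ℕ} (c : K) (F : (Fin n → K) → (Fin r → K))
    (a : Fin n → K) (b : Fin r → K) : ℕ :=
  Set.ncard {xy : (Fin n → K) × (Fin n → K) |
    F (xy.1 + xy.2) - c • F xy.1 = b ∧
    c • F (xy.1 + xy.2 + a) - F (xy.1 + a) = c • b}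

/-! Once the pairs `(x_j, y_j)` with `j > i` are fixed, the `g_i` become nonzero constants. With `u
= x_i + y_i`, `v = x_i`, branch `i` reads `α u ^ d - β v ^ d = b`, `γ (u + a) ^ d - δ (v + a) ^ d =
e`. The table entry is therefore at most the product of bounds for single branches
(`Finset.card_le_prod_of_fibers`).

As `u ↦ u ^ d` is bijective, `v` determines `u`, so a branch has at most `q` solutions. If `d > 1`
and `a b ≠ 0`, Bézout gives `d ^ 2` (`card_le_sq_of_fermat_curves`): the first curve is irreducible
by Eisenstein, it does not divide the second, and their resultant with respect to `u` is a nonzero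
polynomial in `v` of degree at most `d ^ 2`. -/

/-! ### Degrees of determinants and resultants -/

open Polynomial in
/-- If row `i` and column `j` carry weights such that every nonzero entry satisfies
`natDegree (M i j) + r i ≤ s j`, then `natDegree M.det ≤ ∑ s - ∑ r`. -/
theorem Matrix.natDegree_det_le_of_weights {ι R : Type*} [Fintype ι] [DecidableEq ι] [CommRing R]
    (M : Matrix ι ι R[X]) (r s : ι → ℕ) (k : ℕ)
    (hM : ∀ i j, M i j ≠ 0 → (M i j).natDegree + r i ≤ s j)
    (hk : ∑ j, s j ≤ k + ∑ i, r i) : M.det.natDegree ≤ k := by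
  rw [Matrix.det_apply]
  refine Polynomial.natDegree_sum_le_of_forall_le _ _ fun σ _ => ?_
  refine (Polynomial.natDegree_smul_le _ _).trans ?_
  by_cases h0 : ∃ i, M (σ i) i = 0
  · obtain ⟨i, hi⟩ := h0
    have h : ∏ i, M (σ i) i = 0 := Finset.prod_eq_zero (Finset.mem_univ i) hi
    exact (congrArg natDegree h).le.trans (by simp)
  push Not at h0
  refine (Polynomial.natDegree_prod_le _ _).trans ?_
  have h1 := Finset.sum_le_sum fun i (_ : i ∈ Finset.univ) => hM (σ i) i (h0 i)
  rw [Finset.sum_add_distrib, Equiv.sum_comp σ r] at h1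
  omega

open Polynomial in
/-- The degree bound behind Bézout's inequality. -/
theorem Polynomial.natDegree_resultant_le {R : Type*} [CommRing R] (f g : R[X][X]) (m n : ℕ)
    (hf : ∀ k ≤ m, f.coeff k ≠ 0 → (f.coeff k).natDegree + k ≤ m)
    (hg : ∀ k ≤ n, g.coeff k ≠ 0 → (g.coeff k).natDegree + k ≤ n) :
    (f.resultant g m n).natDegree ≤ m * n := by
  -- Column `j` of the left block holds the entries `g.coeff (i - j)`, of degree at most `n - (i -
  -- j)`; hence the weight `n + j`, and `m + j` on the right. The weights exceed the sum of the row
  -- indices by exactly `m * n`.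
  let w : Fin (m + n) → ℕ :=
    Fin.addCases (motive := fun _ => ℕ) (fun j => n + (j : ℕ)) fun j => m + (j : ℕ)
  have hwl : ∀ j : Fin m, w (Fin.castAdd n j) = n + j := fun j => Fin.addCases_left j
  have hwr : ∀ j : Fin n, w (Fin.natAdd m j) = m + j := fun j => Fin.addCases_right j
  rw [resultant]
  refine Matrix.natDegree_det_le_of_weights (sylvester f g m n) (fun i => (i : ℕ)) w _ ?_ ?_
  · intro i j
    induction j using Fin.addCases with
    | left j =>
      simp only [sylvester, Matrix.of_apply, Fin.addCases_left, Set.mem_Icc, hwl]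
      split_ifs with h
      · intro h0
        have := hg (i - j) (by omega) h0
        omega
      · simp
    | right j =>
      simp only [sylvester, Matrix.of_apply, Fin.addCases_right, Set.mem_Icc, hwr]
      split_ifs with h
      · intro h0
        have := hf (i - j) (by omega) h0
        omega
      · simp
  · simp only [Fin.sum_univ_add, hwl, hwr, Fin.val_castAdd,
      Fin.val_natAdd, Finset.sum_add_distrib, Finset.sum_const, Finset.card_univ,
      Fintype.card_fin, smul_eq_mul]
    have := mul_comm m n
    omega

/-! ### Intersection of two Fermat curves -/

open Polynomial in
/-- `u ^ d - (β v ^ d + b)` is irreducible as a polynomial in `u` over `K[v]`. -/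
theorem irreducible_X_pow_sub_C_mul_X_pow_add {K : Type*} [Field K] {d : ℕ} (hd : (d : K) ≠ 0)
    {β b : K} (hβ : β ≠ 0) (hb : b ≠ 0) :
    Irreducible (X ^ d - C (C β * X ^ d + C b) : K[X][X]) := by
  have hd0 : d ≠ 0 := by rintro rfl; simp at hd
  set P : K[X] := C β * X ^ d + C b with hP
  have hdeg : P.natDegree = d := by
    rw [hP, natDegree_add_C, natDegree_C_mul_X_pow d β hβ]
  have hsq : Squarefree P := by
    have h1 : (X ^ d - C (-b / β)).Separable :=
      separable_X_pow_sub_C _ hd (div_ne_zero (neg_ne_zero.2 hb) hβ)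
    have h2 : P = C β * (X ^ d - C (-b / β)) := by
      rw [mul_sub, ← C_mul, mul_div_cancel₀ _ hβ]
      simp [hP]
    rw [h2]
    exact h1.squarefree.squarefree_of_dvd ((isUnit_C.2 hβ.isUnit).mul_left_dvd.2 dvd_rfl)
  obtain ⟨π, hπ, hπP⟩ := exists_irreducible_of_natDegree_ne_zero (hdeg.trans_ne hd0)
  have hmonic : (X ^ d - C P).Monic := monic_X_pow_sub_C P hd0
  -- Eisenstein at `π`: it divides the squarefree `P` exactly once.
  refine irreducible_of_eisenstein_criterion (P := Ideal.span {π})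
    ((Ideal.span_singleton_prime hπ.ne_zero).2 hπ.prime) ?_ ?_ ?_ ?_ hmonic.isPrimitive
  · rw [hmonic.leadingCoeff, Ideal.mem_span_singleton]
    exact fun h => hπ.not_isUnit (isUnit_of_dvd_one h)
  · intro k hk
    rw [degree_X_pow_sub_C (Nat.pos_of_ne_zero hd0), Nat.cast_lt] at hk
    rw [Ideal.mem_span_singleton, coeff_sub, coeff_X_pow, if_neg hk.ne, zero_sub, dvd_neg, coeff_C]
    split_ifs
    exacts [hπP, dvd_zero _]
  · rw [degree_X_pow_sub_C (Nat.pos_of_ne_zero hd0)]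
    exact_mod_cast Nat.pos_of_ne_zero hd0
  · rw [Ideal.span_singleton_pow, Ideal.mem_span_singleton, coeff_sub, coeff_X_pow,
      if_neg hd0.symm, zero_sub, dvd_neg, coeff_C_zero, sq]
    exact fun h => hπ.not_isUnit (hsq π h)

open Polynomial in
/-- A nonproportional second curve: the resultant of `u ^ d - (β v ^ d + b)` and
`γ (u + a) ^ d - Q(v)` does not vanish. -/
theorem resultant_X_pow_sub_C_ne_zero {K : Type*} [Field K] {d : ℕ} (hd : (d : K) ≠ 0)
    (hd1 : d ≠ 1) {a b β γ : K} (ha : a ≠ 0) (hb : b ≠ 0) (hβ : β ≠ 0) (hγ : γ ≠ 0) (Q : K[X]) :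
    (X ^ d - C (C β * X ^ d + C b) : K[X][X]).resultant
      (C (C γ) * (X + C (C a)) ^ d - C Q) d d ≠ 0 := by
  have hd0 : d ≠ 0 := by rintro rfl; simp at hd
  have hirr := irreducible_X_pow_sub_C_mul_X_pow_add hd hβ hb
  set f : K[X][X] := X ^ d - C (C β * X ^ d + C b) with hf
  set g : K[X][X] := C (C γ) * (X + C (C a)) ^ d - C Q with hg
  have hfm : f.Monic := monic_X_pow_sub_C _ hd0
  have hfd : f.natDegree = d := natDegree_X_pow_sub_C
  have hgd : g.natDegree = d := by
    rw [hg, natDegree_sub_C, natDegree_C_mul (C_ne_zero.2 hγ), natDegree_pow, natDegree_X_add_C,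
      mul_one]
  have hinj := IsFractionRing.injective K[X] (RatFunc K)
  have hndvd : ¬ f ∣ g := by
    rintro ⟨h, hfh⟩
    have hg0 : g ≠ 0 := by rintro h0; rw [h0] at hgd; exact hd0 (by simpa using hgd.symm)
    have hh0 : h ≠ 0 := by rintro rfl; exact hg0 (by simpa using hfh)
    have hhd : h.natDegree = 0 := by
      have := congrArg natDegree hfh
      rw [hfm.natDegree_mul' hh0] at this
      omega
    rw [eq_C_of_natDegree_eq_zero hhd] at hfh
    -- The quotient is constant in `u`, but the coefficient of `u ^ (d - 1)` is `0` in `f` and `γ a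
    -- d ≠ 0` in `g`; `d ≠ 1` keeps the constant terms out of it.
    have hc := congrArg (fun q => coeff q (d - 1)) hfh
    have h1 : d - 1 ≠ d := by omega
    have h2 : d - 1 ≠ 0 := by omega
    have h3 : d - (d - 1) = 1 := by omega
    have h4 : d.choose (d - 1) = d := by
      rw [← Nat.choose_symm_of_eq_add (show d = 1 + (d - 1) by omega), Nat.choose_one_right]
    simp only [hf, hg, coeff_sub, coeff_C_mul, coeff_mul_C, coeff_X_pow, coeff_C, if_neg h1,
      if_neg h2, sub_zero, zero_mul, coeff_X_add_C_pow, h3, h4, pow_one] at hc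
    have hdK : (d : K[X]) ≠ 0 := by
      rw [← C_eq_natCast]; exact C_ne_zero.2 hd
    exact mul_ne_zero (C_ne_zero.2 hγ) (mul_ne_zero (C_ne_zero.2 ha) hdK) hc
  -- By Gauss's lemma `f` stays irreducible over the field `K(v)`, where not dividing means coprime.
  have hcop : IsCoprime (f.map (algebraMap K[X] (RatFunc K)))
      (g.map (algebraMap K[X] (RatFunc K))) := by
    refine ((hfm.irreducible_iff_irreducible_map_fraction_map).1 hirr).coprime_iff_not_dvd.2 ?_
    rwa [map_dvd_map _ hinj hfm]
  have hne := resultant_ne_zero _ _ hcop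
  rw [natDegree_map_eq_of_injective hinj, natDegree_map_eq_of_injective hinj, hfd, hgd,
    resultant_map_map] at hne
  exact fun h => hne (by rw [h, map_zero])

open Polynomial in
/-- A Bézout bound for two Fermat curves, when the first coordinate of a common point is determined
by the second one. -/
theorem card_le_sq_of_fermat_curves {K : Type*} [Field K] {d : ℕ} (hd : (d : K) ≠ 0)
    (hd1 : d ≠ 1) {a b e α β γ δ : K} (ha : a ≠ 0) (hb : b ≠ 0) (hα : α ≠ 0) (hβ : β ≠ 0)
    (hγ : γ ≠ 0) (V : Finset K)
    (hV : ∀ v ∈ V, ∃ u, α * u ^ d - β * v ^ d = b ∧ γ * (u + a) ^ d - δ * (v + a) ^ d = e) :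
    V.card ≤ d ^ 2 := by
  have hd0 : d ≠ 0 := by rintro rfl; simp at hd
  set P : K[X] := C (β / α) * X ^ d + C (b / α) with hP
  set Q : K[X] := C δ * (X + C a) ^ d + C e with hQ
  have hPd : P.natDegree ≤ d := by rw [hP]; compute_degree
  have hQd : Q.natDegree ≤ d := by rw [hQ]; compute_degree
  have hR := resultant_X_pow_sub_C_ne_zero hd hd1 ha (div_ne_zero hb hα) (div_ne_zero hβ hα) hγ Q
  rw [← hP] at hR
  set f : K[X][X] := X ^ d - C P with hf
  set g : K[X][X] := C (C γ) * (X + C (C a)) ^ d - C Q with hg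
  have hfd : f.natDegree ≤ d := natDegree_X_pow_sub_C.le
  have hgd : g.natDegree ≤ d := by rw [hg]; compute_degree
  -- The resultant lies in the ideal `(f, g)`, so it vanishes at the `v`-coordinate of every common
  -- point.
  obtain ⟨r, s, -, -, hrs⟩ := exists_mul_add_mul_eq_C_resultant f g hfd hgd (Or.inl hd0)
  have hdeg : (f.resultant g d d).natDegree ≤ d * d := by
    refine natDegree_resultant_le f g d d (fun k hk _ => ?_) (fun k hk _ => ?_)
    · rw [hf, coeff_sub, coeff_X_pow, coeff_C]
      split_ifs with h1 h2 h2
      · omega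
      · simpa using h1.le
      · simpa [h2] using hPd
      · simpa using hk
    · rw [hg, coeff_sub, coeff_C_mul, coeff_X_add_C_pow, coeff_C, ← C_pow, ← C_eq_natCast,
        ← C_mul, ← C_mul]
      split_ifs with h
      · rw [h, add_zero]
        exact (natDegree_sub_le _ _).trans (max_le (by compute_degree!) hQd)
      · rw [sub_zero, natDegree_C]
        omega
  rw [sq]
  refine le_trans ?_ hdeg
  refine card_le_degree_of_subset_roots (p := f.resultant g d d) fun v hv => ?_
  rw [Finset.mem_val] at hv
  rw [mem_roots hR, IsRoot]
  obtain ⟨u, h1, h2⟩ := hV v hv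
  have := congrArg (fun q => eval v (eval (C u) q)) hrs
  simp only [eval_add, eval_mul, eval_C] at this
  rw [← this]
  have hfu : eval v (eval (C u) f) = 0 := by
    simp only [hf, hP, eval_sub, eval_add, eval_mul, eval_pow, eval_X, eval_C]
    field_simp
    linear_combination h1
  have hgu : eval v (eval (C u) g) = 0 := by
    simp only [hg, hQ, eval_sub, eval_add, eval_mul, eval_pow, eval_X, eval_C]
    linear_combination h2
  rw [hfu, hgu, zero_mul, zero_mul, add_zero]

/-! ### Counting tuples coordinate by coordinate -/

/-- The number of points of a set of tuples is bounded by the product of bounds on the number of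
values of each coordinate once all later coordinates are fixed. -/
theorem Finset.card_le_prod_of_fibers {L : Type*} [DecidableEq L] {n : ℕ}
    (S : Finset (Fin n → L)) (B : Fin n → ℕ)
    (hS : ∀ i, ∀ T ⊆ S, (∀ s ∈ T, ∀ t ∈ T, ∀ j, i < j → s j = t j) →
      (T.image fun s => s i).card ≤ B i) : S.card ≤ ∏ i, B i := by
  induction n with
  | zero => simpa using Finset.card_le_one_of_subsingleton S
  | succ n ih =>
    rw [Fin.prod_univ_succ]
    refine (Finset.card_le_mul_card_image (f := Fin.tail) S (B 0) fun z _ => ?_).trans ?_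
    · rw [← Finset.card_image_of_injOn (f := fun s : Fin (n + 1) → L => s 0)]
      · refine hS 0 _ (Finset.filter_subset _ _) fun s hs t ht j hj => ?_
        obtain ⟨j, rfl⟩ := Fin.exists_succ_eq.2 hj.ne'
        exact congrFun ((Finset.mem_filter.1 hs).2.trans (Finset.mem_filter.1 ht).2.symm) j
      · intro s hs t ht hst
        rw [← Fin.cons_self_tail s, ← Fin.cons_self_tail t, (Finset.mem_filter.1 hs).2,
          (Finset.mem_filter.1 ht).2]
        exact congrArg (fun w => (Fin.cons w z : Fin (n + 1) → L)) hst
    · refine Nat.mul_le_mul_left _ (ih _ (fun i => B i.succ) fun i T hT hj => ?_)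
      -- A set `T` of tails is lifted to all tuples of `S` lying over it.
      have h := hS i.succ (S.filter fun s => Fin.tail s ∈ T) (Finset.filter_subset _ _) ?_
      · refine (Finset.card_le_card fun w hw => ?_).trans h
        obtain ⟨t, ht, rfl⟩ := Finset.mem_image.1 hw
        obtain ⟨s, hs, rfl⟩ := Finset.mem_image.1 (hT ht)
        exact Finset.mem_image.2 ⟨s, Finset.mem_filter.2 ⟨hs, ht⟩, rfl⟩
      · intro s hs t ht j hij
        obtain ⟨j, rfl⟩ := Fin.exists_succ_eq.2 ((Fin.zero_le _).trans_lt hij).ne'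
        exact hj _ (Finset.mem_filter.1 hs).2 _ (Finset.mem_filter.1 ht).2 j
          (Fin.succ_lt_succ_iff.1 hij)

theorem Finset.card_le_prod_castSucc_mul_last {L : Type*} [DecidableEq L] {m : ℕ}
    (S : Finset (Fin (m + 1) → L)) (B : Fin m → ℕ) (k : ℕ)
    (hlast : (S.image fun s => s (Fin.last m)).card ≤ k)
    (hS : ∀ i : Fin m, ∀ T ⊆ S, (∀ s ∈ T, ∀ t ∈ T, ∀ j, i.castSucc < j → s j = t j) →
      (T.image fun s => s i.castSucc).card ≤ B i) : S.card ≤ (∏ i, B i) * k := by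
  have h := S.card_le_prod_of_fibers (Fin.snoc (α := fun _ => ℕ) B k) fun i T hTS hT => ?_
  · simpa [Fin.prod_univ_castSucc] using h
  · induction i using Fin.lastCases with
    | last =>
      rw [Fin.snoc_last]
      exact (Finset.card_le_card (Finset.image_subset_image hTS)).trans hlast
    | cast i =>
      rw [Fin.snoc_castSucc]
      exact hS i T hTS hT

/-! ### Solutions of a single branch -/

section Branch

variable {K : Type*} [Field K] {d : ℕ} {a b e α β γ δ : K}

/-- Solutions `(x, y)` of the first equation of a branch are determined by `x`. -/
theorem injOn_fst_of_pow_bijective (hbij : Function.Bijective fun x : K => x ^ d) (hα : α ≠ 0)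
    (T : Finset (K × K)) (hT : ∀ w ∈ T, α * (w.1 + w.2) ^ d - β * w.1 ^ d = b) :
    Set.InjOn Prod.fst (T : Set (K × K)) := by
  rintro ⟨x, y⟩ hs ⟨x', y'⟩ ht (rfl : x = x')
  have h : α * (x + y) ^ d = α * (x + y') ^ d := by
    linear_combination hT _ hs - hT _ ht
  have := hbij.1 (mul_left_cancel₀ hα h)
  rw [add_left_cancel this]

theorem card_branch_le_card [Fintype K] (hbij : Function.Bijective fun x : K => x ^ d) (hα : α ≠ 0)
    (T : Finset (K × K)) (hT : ∀ w ∈ T, α * (w.1 + w.2) ^ d - β * w.1 ^ d = b) :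
    T.card ≤ Fintype.card K := by
  classical
  rw [← Finset.card_image_of_injOn (injOn_fst_of_pow_bijective hbij hα T hT)]
  exact Finset.card_le_univ _

theorem card_branch_le_sq (hbij : Function.Bijective fun x : K => x ^ d) (hd : (d : K) ≠ 0)
    (hd1 : d ≠ 1) (ha : a ≠ 0) (hb : b ≠ 0) (hα : α ≠ 0) (hβ : β ≠ 0) (hγ : γ ≠ 0)
    (T : Finset (K × K)) (hT : ∀ w ∈ T, α * (w.1 + w.2) ^ d - β * w.1 ^ d = b ∧
      γ * (w.1 + w.2 + a) ^ d - δ * (w.1 + a) ^ d = e) :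
    T.card ≤ d ^ 2 := by
  classical
  rw [← Finset.card_image_of_injOn (injOn_fst_of_pow_bijective hbij hα T fun w hw => (hT w hw).1)]
  refine card_le_sq_of_fermat_curves (e := e) (δ := δ) hd hd1 ha hb hα hβ hγ _ fun v hv => ?_
  obtain ⟨w, hw, rfl⟩ := Finset.mem_image.1 hv
  exact ⟨_, hT w hw⟩

/-- The linear system of the last branch has at most one solution. -/
theorem card_linear_branch_le_one {c : K} (hc : c ≠ 1 ∧ (c ≠ -1 ∨ a ≠ 0)) (T : Finset (K × K))
    (hT : ∀ w ∈ T, (w.1 + w.2) - c * w.1 = b ∧ c * (w.1 + w.2 + a) - (w.1 + a) = c * b) :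
    T.card ≤ 1 := by
  -- The second equation minus `c` times the first is `(c - 1) * ((c + 1) * x + a) = 0`.
  have key : ∀ w ∈ T, (c + 1) * w.1 = -a := by
    intro w hw
    obtain ⟨h1, h2⟩ := hT w hw
    refine mul_left_cancel₀ (sub_ne_zero.2 hc.1) ?_
    linear_combination h2 - c * h1
  refine Finset.card_le_one.2 fun w hw z hz => ?_
  have hc1 : c + 1 ≠ 0 := by
    intro h
    have ha : a = 0 := by simpa [h] using key w hw
    exact hc.2.elim (fun h' => h' (eq_neg_of_add_eq_zero_left h)) fun h' => h' ha
  have h1 : w.1 = z.1 := mul_left_cancel₀ hc1 ((key w hw).trans (key z hz).symm)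
  refine Prod.ext h1 ?_
  linear_combination (hT w hw).1 - (hT z hz).1 + (c - 1) * h1

end Branch

/-! ### Reduction of the system to its branches -/

namespace GTDS

variable {K : Type*} [Field K] {m : ℕ} (F : GTDS K m)

theorem map_last {k : ℕ} (hp : F.p (Fin.last m) = Polynomial.X ^ k) (x : Fin (m + 1) → K) :
    F.map x (Fin.last m) = x (Fin.last m) ^ k := by
  simp [map, poly, hp]

theorem map_castSucc {i : Fin m} {k : ℕ} (hp : F.p i.castSucc = Polynomial.X ^ k)
    (hh : F.h i = 0) (x : Fin (m + 1) → K) :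
    F.map x i.castSucc = MvPolynomial.eval (fun j => x j.1) (F.g i) * x i.castSucc ^ k := by
  simp [map, poly, hp, hh, MvPolynomial.eval_rename, Function.comp_def, mul_comm]

end GTDS

theorem mainTheorem3 {K : Type*} [Field K] [Fintype K] [DecidableEq K] (p : ℕ) [CharP K p]
    (m : ℕ) (F : GTDS K m) (d : Fin (m + 1) → ℕ)
    (hp : ∀ i, F.p i = Polynomial.X ^ d i)
    (hgcd : ∀ i, Nat.gcd (d i) (Fintype.card K - 1) = 1)
    (hpd : ∀ i, ¬ p ∣ d i)
    (hh : ∀ i, F.h i = 0)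
    (a b : Fin (m + 1) → K) (ha : a ≠ 0) (hb : b ≠ 0) (c : K) (hc : c ≠ 0) :
    cBCT c F.map a b ≤
      (if d (Fin.last m) = 1 then
          (if c ≠ 1 ∧ (c ≠ -1 ∨ a (Fin.last m) ≠ 0) then 1 else Fintype.card K)
        else if a (Fin.last m) * b (Fin.last m) = 0 then Fintype.card K
        else d (Fin.last m) ^ 2) *
      ∏ i : Fin m,
        (if d i.castSucc = 1 ∨ a i.castSucc * b i.castSucc = 0 then Fintype.card K
          else d i.castSucc ^ 2) := by
  have hbij : ∀ i, Function.Bijective fun x : K => x ^ d i := fun i => by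
    simpa [hp i] using F.p_perm i
  have hd : ∀ i, (d i : K) ≠ 0 := fun i h => hpd i ((CharP.cast_eq_zero_iff K p _).1 h)
  classical
  -- A pair of vectors is recoded as a vector of pairs, so that one coordinate carries one branch.
  let S : Finset (Fin (m + 1) → K × K) := Finset.univ.filter fun w =>
    F.map ((fun i => (w i).1) + fun i => (w i).2) - c • F.map (fun i => (w i).1) = b ∧
    c • F.map ((fun i => (w i).1) + (fun i => (w i).2) + a) - F.map ((fun i => (w i).1) + a) = c • b
  have hS : cBCT c F.map a b = S.card := by
    rw [cBCT, ← Set.ncard_coe_finset]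
    refine Set.ncard_congr (fun w _ i => (w.1 i, w.2 i)) ?_ ?_ ?_
    · intro w hw
      simpa [S] using hw
    · intro w z _ _ h
      exact Prod.ext (funext fun i => congrArg Prod.fst (congrFun h i))
        (funext fun i => congrArg Prod.snd (congrFun h i))
    · intro w hw
      exact ⟨(fun i => (w i).1, fun i => (w i).2), by simpa [S] using hw, rfl⟩
  have hSi : ∀ w ∈ S, ∀ i,
      F.map ((fun i => (w i).1) + fun i => (w i).2) i - c * F.map (fun i => (w i).1) i = b i ∧
      c * F.map ((fun i => (w i).1) + (fun i => (w i).2) + a) i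
        - F.map ((fun i => (w i).1) + a) i = c * b i := fun w hw i =>
    ⟨congrFun (Finset.mem_filter.1 hw).2.1 i, congrFun (Finset.mem_filter.1 hw).2.2 i⟩
  rw [hS, mul_comm]
  refine S.card_le_prod_castSucc_mul_last _ _ ?_ fun i T hTS hT => ?_
  · have hsol : ∀ w ∈ S.image fun s => s (Fin.last m),
        1 * (w.1 + w.2) ^ d (Fin.last m) - c * w.1 ^ d (Fin.last m) = b (Fin.last m) ∧
        c * (w.1 + w.2 + a (Fin.last m)) ^ d (Fin.last m)
          - 1 * (w.1 + a (Fin.last m)) ^ d (Fin.last m) = c * b (Fin.last m) := by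
      intro w hw
      obtain ⟨s, hs, rfl⟩ := Finset.mem_image.1 hw
      simpa [F.map_last (hp _)] using hSi s hs (Fin.last m)
    split_ifs with h1 h2 h3
    · refine card_linear_branch_le_one (b := b (Fin.last m)) h2 _ fun w hw => ?_
      simpa [h1] using hsol w hw
    · exact card_branch_le_card (hbij _) one_ne_zero _ fun w hw => (hsol w hw).1
    · exact card_branch_le_card (hbij _) one_ne_zero _ fun w hw => (hsol w hw).1
    · rw [mul_eq_zero, not_or] at h3
      exact card_branch_le_sq (hbij _) (hd _) h1 h3.1 h3.2 one_ne_zero hc hc _ hsol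
  -- All members of `T` agree with a reference solution `t` beyond `i`, so `t` supplies the common
  -- values of `g_i`.
  · obtain rfl | ⟨t, ht⟩ := T.eq_empty_or_nonempty
    · simp
    have hg := F.g_ne_zero i
    set G : (Fin (m + 1) → K) → K := fun x => MvPolynomial.eval (fun j => x j.1) (F.g i) with hG
    have hG0 : ∀ x, G x ≠ 0 := fun x => hg _
    have hmap : ∀ x, F.map x i.castSucc = G x * x i.castSucc ^ d i.castSucc :=
      F.map_castSucc (hp _) (hh i)
    have hGeq : ∀ x y : Fin (m + 1) → K, (∀ j, i.castSucc < j → x j = y j) → G x = G y := by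
      intro x y hxy
      exact congrArg (fun z => MvPolynomial.eval z (F.g i)) (funext fun j => hxy j.1 j.2)
    have hsol : ∀ w ∈ T.image fun s => s i.castSucc,
        G ((fun i => (t i).1) + fun i => (t i).2) * (w.1 + w.2) ^ d i.castSucc
          - c * G (fun i => (t i).1) * w.1 ^ d i.castSucc = b i.castSucc ∧
        c * G ((fun i => (t i).1) + (fun i => (t i).2) + a)
            * (w.1 + w.2 + a i.castSucc) ^ d i.castSucc
          - G ((fun i => (t i).1) + a) * (w.1 + a i.castSucc) ^ d i.castSucc
          = c * b i.castSucc := by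
      intro w hw
      obtain ⟨s, hs, rfl⟩ := Finset.mem_image.1 hw
      have hst := hT t ht s hs
      rw [hGeq ((fun i => (t i).1) + fun i => (t i).2) ((fun i => (s i).1) + fun i => (s i).2)
          fun j hj => by simp [hst j hj],
        hGeq (fun i => (t i).1) (fun i => (s i).1) fun j hj => by simp [hst j hj],
        hGeq ((fun i => (t i).1) + (fun i => (t i).2) + a)
          ((fun i => (s i).1) + (fun i => (s i).2) + a) fun j hj => by simp [hst j hj],
        hGeq ((fun i => (t i).1) + a) ((fun i => (s i).1) + a) fun j hj => by simp [hst j hj]]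
      have := hSi s (hTS hs) i.castSucc
      simp only [hmap, Pi.add_apply] at this
      simpa only [mul_assoc] using this
    split_ifs with h1
    · exact card_branch_le_card (hbij _) (hG0 _) _ fun w hw => (hsol w hw).1
    · rw [mul_eq_zero, not_or, not_or] at h1
      have hα := hG0 ((fun i => (t i).1) + fun i => (t i).2)
      have hβ := mul_ne_zero hc (hG0 fun i => (t i).1)
      have hγ := mul_ne_zero hc (hG0 ((fun i => (t i).1) + (fun i => (t i).2) + a))
      clear_value G
      exact card_branch_le_sq (hbij i.castSucc) (hd i.castSucc) h1.1 h1.2.1 h1.2.2 hα hβ hγ _ hsol
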